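/- For a compact set $K\subset\mathbb C$ let $\|f\|_K:=\sup_{z\in K}|f(z)|$ (with $\|f\|_\emptyset:=0$), and let $\mathcal P_n$ be the set of complex polynomials of degree at most $n$. For $f\in\mathcal C(K)$ put $\operatorname{dist}_K(f,\mathcal P_n):=\inf\{\|f-p\|_K: p\in\mathcal P_n\}$, and for real $\ell\ge 0$ define the Jackson norm (on $K$) $$|f|_\ell:=\|f\|_K+\sup_{n\in\mathbb N} n^\ell\operatorname{dist}_K(f,\mathcal P_n)\in[0,\infty],\qquad \mathbb N=\{1,2,\dots\}.$$ Let $s(K):=\{f\in\mathcal C(K): \lim_{n\to\infty}n^\ell\operatorname{dist}_K(f,\mathcal P_n)=0\ \text{for all }\ell\in\mathbb N\}$. The set $K$ is called polynomially convex if $K=\{z\in\mathbb C: |p(z)|\le\|p\|_K\text{ for every complex polynomial }p\}$. It is called non-polar if its logarithmic capacity $\operatorname{cap}K=\sup_\mu \exp\bigl(-\iint\log\frac1{|z-w|}\,d\mu(z)\,d\mu(w)\bigr)$ is positive, the supremum being taken over all Borel probability measures $\mu$ on $K$. **Lemma 4.2.** Let $E=A\cup B$, where $A,B\subset\mathbb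 C$ are disjoint, compact and polynomially convex, and $A$ is non-polar. Then there is a constant $c\ge1$, depending only on $A$ and $B$, such that for every $f\in\mathcal C(E)$ with $f|_A\in s(A)$ and $f|_B\equiv0$ we have $f\in s(E)$ and $$|f|_\ell\le(c\ell)^\ell\,\bigl|f|_A\bigr|_\ell\qquad\text{for all real }\ell\ge1,$$ where the Jackson norm on the left is taken on $E$ and the one on the right on $A$. -/

import Mathlib

open MeasureTheory Filter Topology
open scoped ENNReal

noncomputable section

namespace PolyApprox

/-- The supremum norm `‖f‖_E` of `f` over the set `E`. It is only applied to functions that are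
continuous on a compact set `E`, where the supremum is finite; for `E = ∅` it is `0`. -/
def supNorm (E : Set ℂ) (f : ℂ → ℂ) : ℝ :=
  ⨆ z : E, ‖f z‖

/-- `dist_E(f, 𝒫_n)`: the error of best uniform approximation of `f` on `E` by polynomials of
degree `n` or less. -/
def polyDist (E : Set ℂ) (f : ℂ → ℂ) (n : ℕ) : ℝ :=
  ⨅ p : {p : Polynomial ℂ // p.natDegree ≤ n}, supNorm E (fun z => f z - p.1.eval z)

/-- The class `s(E)` of continuous functions on `E` that are rapidly approximated by polynomials.
A function on `E` is given by any function on `ℂ` with these values on `E`: nothing below depends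
on the values outside `E`, so that the restriction of `f` to `A ⊆ E` is again written `f`. -/
def sClass (E : Set ℂ) : Set (ℂ → ℂ) :=
  {f | ContinuousOn f E ∧
    ∀ l : ℕ, 1 ≤ l → Tendsto (fun n : ℕ => (n : ℝ) ^ l * polyDist E f n) atTop (𝓝 0)}

/-- The Jackson norm `|f|_ℓ = ‖f‖_E + sup_{n ≥ 1} n^ℓ dist_E(f, 𝒫_n)` for real `ℓ`, with values
in `[0, ∞]`, so that the supremum is a true supremum. -/
def jacksonNorm (E : Set ℂ) (f : ℂ → ℂ) (l : ℝ) : ℝ≥0∞ :=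
  ENNReal.ofReal (supNorm E f) +
    ⨆ n : ℕ, ⨆ _ : 1 ≤ n, ENNReal.ofReal ((n : ℝ) ^ l * polyDist E f n)

/-- The polynomial hull of a compact set `E`. -/
def polyHull (E : Set ℂ) : Set ℂ :=
  {z | ∀ p : Polynomial ℂ, ‖p.eval z‖ ≤ supNorm E (fun w => p.eval w)}

/-- `E` is polynomially convex: it equals its polynomial hull. -/
def PolyConvex (E : Set ℂ) : Prop :=
  E = polyHull E

/-- The logarithmic energy `I(μ) = ∬ log (1 / |z - w|) dμ(w) dμ(z)`, as the difference of the
integrals of the positive and the negative part of the kernel. The kernel is `+∞` on the diagonal,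
since `ENNReal.log 0 = ⊥`. For a probability measure on a compact set the second
integral is finite, so that `I(μ)` is well defined in `(-∞, ∞]`. -/
def logEnergy (μ : Measure ℂ) : EReal :=
  ((∫⁻ z, ∫⁻ w, (-ENNReal.log (edist z w)).toENNReal ∂μ ∂μ : ℝ≥0∞) : EReal) -
    ((∫⁻ z, ∫⁻ w, (ENNReal.log (edist z w)).toENNReal ∂μ ∂μ : ℝ≥0∞) : EReal)

/-- The logarithmic capacity `cap E = sup_μ exp (-I(μ))` of a compact set `E`, the supremum being
over all Borel probability measures carried by `E`. -/
def logCap (E : Set ℂ) : ℝ≥0∞ :=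
  ⨆ (μ : Measure ℂ) (_ : IsProbabilityMeasure μ) (_ : μ Eᶜ = 0), EReal.exp (-logEnergy μ)

end PolyApprox

end

/-! If `p` of degree at most `n` approximates `f` on `A`, multiply it by a cutoff polynomial that is
near `1` on `A` and near `0` on `B`. Since `A` is non-polar, Bernstein–Walsh
(`exists_norm_eval_le_pow_mul`) bounds `p` on `B` by `M ^ n` times its size on `A`, so the cutoff
must have error about `(2M)⁻ⁿ` at degree `O(n)`. Such a cutoff is `S ∘ q`, where `q` is a fixed
polynomial within `1 / (16 M)` of the indicator of `A` on `A ∪ B` and `S` is a smoothstep of degree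
at most `2n + 1` (`exists_smoothstep`). This gives `exists_polyDist_union_le`; the Jackson estimate
follows from `n ^ l * 2⁻ⁿ ≤ l ^ l`.

The polynomial `q` comes from a Runge-type argument in the uniform closure of the polynomials on `E
= A ∪ B`. Polynomial convexity gives each `z - a` with `a` outside the set a continuous logarithm on
`A` and on `B`. These logarithms glue on the disjoint union, and topology then forbids holes: the
spectrum of the coordinate function in this algebra is no larger than `E`
(`not_mem_spectrum_coord`). Hence the Cauchy kernel may be replaced by the resolvent in a
Cauchy–Pompeiu integral, which places the indicator of `A` in the algebra (`exists_polyAlgebra_eq`).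
-/

namespace PolyApprox

/-! ### Logarithmic potentials and the Bernstein–Walsh inequality -/

/-- The truncated logarithmic kernel `log⁺ (1 / |a - w|)`. -/
noncomputable def logKernel (a w : ℂ) : ℝ≥0∞ := (-ENNReal.log (edist a w)).toENNReal

lemma measurable_logKernel : Measurable (Function.uncurry logKernel) := by
  have h : Measurable fun p : ℂ × ℂ => ENNReal.log (edist p.1 p.2) :=
    ENNReal.measurable_log.comp (measurable_fst.edist measurable_snd)
  exact measurable_ereal_toENNReal.comp h.neg

lemma measurable_logKernel_right (a : ℂ) : Measurable (logKernel a) :=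
  measurable_logKernel.of_uncurry_left

lemma logKernel_self (a : ℂ) : logKernel a a = ⊤ := by
  simp [logKernel]

lemma logKernel_of_ne {a w : ℂ} (h : a ≠ w) :
    logKernel a w = ENNReal.ofReal (-Real.log (dist a w)) := by
  rw [logKernel, edist_dist, ENNReal.log_ofReal_of_pos (dist_pos.2 h), ← EReal.coe_neg,
    EReal.toENNReal_of_ne_top (EReal.coe_ne_top _), EReal.toReal_coe]

lemma exp_neg_logKernel_le_dist {a w : ℂ} (h : logKernel a w ≠ ⊤) :
    Real.exp (-(logKernel a w).toReal) ≤ dist a w := by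
  have hne : a ≠ w := by
    rintro rfl
    exact h (logKernel_self a)
  rw [logKernel_of_ne hne, ← Real.le_log_iff_exp_le (dist_pos.2 hne), ENNReal.toReal_ofReal']
  linarith [le_max_left (-Real.log (dist a w)) 0]

lemma logKernel_le_add_log_two {a z w : ℂ} (h : dist z w ≤ 2 * dist a w) :
    logKernel a w ≤ logKernel z w + ENNReal.ofReal (Real.log 2) := by
  rcases eq_or_ne z w with rfl | hz
  · simp [logKernel_self]
  have ha : a ≠ w := by
    rintro rfl
    rw [dist_self, mul_zero] at h
    exact hz (dist_le_zero.1 h)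
  rw [logKernel_of_ne ha, logKernel_of_ne hz]
  refine le_trans (ENNReal.ofReal_le_ofReal ?_) ENNReal.ofReal_add_le
  have := Real.log_le_log (dist_pos.2 hz) h
  rw [Real.log_mul two_ne_zero (dist_pos.2 ha).ne'] at this
  linarith

/-- A compact set of positive capacity carries a probability measure of finite energy. -/
lemma exists_lintegral_logKernel_ne_top {A : Set ℂ} (hA : IsCompact A) (hcap : 0 < logCap A) :
    ∃ μ : Measure ℂ, IsProbabilityMeasure μ ∧ μ Aᶜ = 0 ∧
      ∫⁻ z, ∫⁻ w, logKernel z w ∂μ ∂μ ≠ ⊤ := by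
  simp only [logCap, lt_iSup_iff] at hcap
  obtain ⟨μ, hμ, hμA, hpos⟩ := hcap
  refine ⟨μ, hμ, hμA, fun htop => ?_⟩
  have hae : ∀ᵐ z ∂μ, z ∈ A := by
    rw [ae_iff]
    exact hμA
  -- Finiteness matters here: in `EReal`, `⊤ - ⊤ = ⊥`, which would make the exponential infinite
  -- rather than zero.
  have hfin : ∫⁻ z, ∫⁻ w, (ENNReal.log (edist z w)).toENNReal ∂μ ∂μ ≠ ⊤ := by
    obtain ⟨D, hD⟩ := Metric.isBounded_iff.1 hA.isBounded
    have hb : ∫⁻ z, ∫⁻ w, (ENNReal.log (edist z w)).toENNReal ∂μ ∂μ ≤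
        ∫⁻ _, ∫⁻ _, (ENNReal.log (ENNReal.ofReal (max D 1))).toENNReal ∂μ ∂μ := by
      refine lintegral_mono_ae (hae.mono fun z hz => lintegral_mono_ae (hae.mono fun w hw => ?_))
      refine EReal.toENNReal_le_toENNReal (ENNReal.log_le_log ?_)
      rw [edist_dist]
      exact ENNReal.ofReal_le_ofReal ((hD hz hw).trans (le_max_left _ _))
    refine ne_top_of_le_ne_top ?_ hb
    rw [ENNReal.log_ofReal_of_pos (by positivity)]
    simp
  have : logEnergy μ = ⊤ := by
    rw [logEnergy]
    change ((∫⁻ z, ∫⁻ w, logKernel z w ∂μ ∂μ : ℝ≥0∞) : EReal) - _ = ⊤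
    rw [htop]
    lift (∫⁻ z, ∫⁻ w, (ENNReal.log (edist z w)).toENNReal ∂μ ∂μ) to NNReal using hfin with r
    exact EReal.top_sub_coe r
  rw [this] at hpos
  simp at hpos

/-- A compact set of positive capacity carries a nonzero measure of bounded potential. -/
lemma exists_lintegral_logKernel_le {A : Set ℂ} (hA : IsCompact A) (hcap : 0 < logCap A) :
    ∃ (μ : Measure ℂ) (S : Set ℂ) (K : ℝ≥0∞), IsProbabilityMeasure μ ∧ S ⊆ A ∧
      μ S ≠ 0 ∧ K ≠ ⊤ ∧ ∀ a, ∫⁻ w in S, logKernel a w ∂μ ≤ K := by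
  obtain ⟨μ, hμ, hμA, hfin⟩ := exists_lintegral_logKernel_ne_top hA hcap
  set u : ℂ → ℝ≥0∞ := fun z => ∫⁻ w, logKernel z w ∂μ with hu
  have humeas : Measurable u := measurable_logKernel.lintegral_prod_right'
  have hae := ae_lt_top humeas hfin
  have hex : ∃ n : ℕ, μ ({z | u z ≤ n} ∩ A) ≠ 0 := by
    by_contra! hcon
    have h0 : μ (⋃ n : ℕ, {z | u z ≤ n} ∩ A) = 0 := measure_iUnion_null hcon
    have h1 : μ (({z | u z ≤ ⊤} \ {z | u z < ⊤}) ∪ Aᶜ) = 0 := by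
      refine measure_union_null ?_ hμA
      rw [ae_iff] at hae
      refine measure_mono_null ?_ hae
      intro z hz
      exact hz.2
    have h2 := measure_union_null h0 h1
    have h3 : (Set.univ : Set ℂ) ⊆
        (⋃ n : ℕ, {z | u z ≤ n} ∩ A) ∪ (({z | u z ≤ ⊤} \ {z | u z < ⊤}) ∪ Aᶜ) := by
      intro z _
      by_cases hzA : z ∈ A
      · by_cases hz : u z < ⊤
        · obtain ⟨n, hn⟩ := ENNReal.exists_nat_gt hz.ne
          exact Or.inl (Set.mem_iUnion.2 ⟨n, hn.le, hzA⟩)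
        · exact Or.inr (Or.inl ⟨(le_top : u z ≤ ⊤), hz⟩)
      · exact Or.inr (Or.inr hzA)
    have h4 := measure_mono_null h3 h2
    simp at h4
  obtain ⟨n, hn⟩ := hex
  have hmeas : MeasurableSet ({z | u z ≤ n} ∩ A) :=
    (measurableSet_le humeas measurable_const).inter hA.measurableSet
  -- Compactness is needed for nearest points in `S`; the potential of `μ` is at most `n` on `S`.
  obtain ⟨S, hS, hSc, hSpos⟩ := hmeas.exists_lt_isCompact (pos_iff_ne_zero.2 hn)
  refine ⟨μ, S, n + ENNReal.ofReal (Real.log 2), hμ, fun z hz => (hS hz).2, hSpos.ne',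
    by finiteness, fun a => ?_⟩
  have hSne : S.Nonempty := by
    by_contra h
    rw [Set.not_nonempty_iff_eq_empty] at h
    simp [h] at hSpos
  -- A weak maximum principle: the point `z` of `S` nearest to `a` satisfies `|z - w| ≤ 2 |a - w|`
  -- for all `w ∈ S`, so passing from `z` to `a` raises the potential by at most `log 2`.
  obtain ⟨z, hz, hdist⟩ := hSc.exists_infDist_eq_dist hSne a
  have hle : ∀ w ∈ S, logKernel a w ≤ logKernel z w + ENNReal.ofReal (Real.log 2) := by
    intro w hw
    refine logKernel_le_add_log_two ?_
    have h1 : dist a z ≤ dist a w := hdist ▸ Metric.infDist_le_dist_of_mem hw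
    have h2 := dist_triangle z a w
    rw [dist_comm z a] at h2
    linarith
  calc ∫⁻ w in S, logKernel a w ∂μ
      ≤ ∫⁻ w in S, (logKernel z w + ENNReal.ofReal (Real.log 2)) ∂μ :=
        setLIntegral_mono' hSc.measurableSet hle
    _ ≤ ∫⁻ w, (logKernel z w + ENNReal.ofReal (Real.log 2)) ∂μ := setLIntegral_le_lintegral _ _
    _ = u z + ENNReal.ofReal (Real.log 2) := by
        rw [lintegral_add_right _ measurable_const]
        simp [hu]
    _ ≤ n + ENNReal.ofReal (Real.log 2) := by
        gcongr
        exact (hS hz).1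

lemma measurable_sum_logKernel (s : Multiset ℂ) :
    Measurable fun w => (s.map fun a => logKernel a w).sum := by
  induction s using Multiset.induction_on with
  | empty => simp
  | cons a s ih =>
    simp only [Multiset.map_cons, Multiset.sum_cons]
    exact (measurable_logKernel_right a).add ih

lemma lintegral_sum_logKernel_le {μ : Measure ℂ} {S : Set ℂ} {K : ℝ≥0∞}
    (h : ∀ a, ∫⁻ w in S, logKernel a w ∂μ ≤ K) (s : Multiset ℂ) :
    ∫⁻ w in S, (s.map fun a => logKernel a w).sum ∂μ ≤ Multiset.card s * K := by
  induction s using Multiset.induction_on with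
  | empty => simp
  | cons a s ih =>
    simp only [Multiset.map_cons, Multiset.sum_cons, Multiset.card_cons]
    rw [lintegral_add_left (measurable_logKernel_right a)]
    push_cast
    rw [add_mul, one_mul, add_comm]
    exact add_le_add ih (h a)

/-- Works factor by factor: with `v = log⁺ (1 / |w - a|)` one has `1 ≤ exp v * |w - a|`, hence `|z -
a| ≤ D + |w - a| ≤ (1 + D) * exp v * |w - a|`. Finiteness of the sum says that `w` is none of the
`a`. -/
lemma norm_prod_le_of_logKernel {z w : ℂ} {D : ℝ} (hD : dist z w ≤ D) (s : Multiset ℂ)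
    (hs : (s.map fun a => logKernel a w).sum ≠ ⊤) :
    ‖(s.map fun a => z - a).prod‖ ≤
      (1 + D) ^ Multiset.card s * Real.exp ((s.map fun a => logKernel a w).sum).toReal *
        ‖(s.map fun a => w - a).prod‖ := by
  have hD0 : 0 ≤ D := dist_nonneg.trans hD
  induction s using Multiset.induction_on with
  | empty => simp
  | cons a s ih =>
    simp only [Multiset.map_cons, Multiset.sum_cons, Multiset.prod_cons, norm_mul,
      Multiset.card_cons] at hs ⊢
    obtain ⟨ha, hs'⟩ := ENNReal.add_ne_top.1 hs
    rw [ENNReal.toReal_add ha hs', Real.exp_add]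
    have h1 := exp_neg_logKernel_le_dist ha
    set v := (logKernel a w).toReal
    have hv : 0 ≤ v := ENNReal.toReal_nonneg
    have h3 : 1 ≤ Real.exp v * ‖w - a‖ := by
      rw [dist_comm, dist_eq_norm, Real.exp_neg] at h1
      have := mul_le_mul_of_nonneg_left h1 (Real.exp_pos v).le
      rwa [mul_inv_cancel₀ (Real.exp_pos v).ne'] at this
    have h4 : ‖z - a‖ ≤ (1 + D) * Real.exp v * ‖w - a‖ := by
      have h5 : ‖z - a‖ ≤ D + ‖w - a‖ := by
        rw [dist_eq_norm] at hD
        calc ‖z - a‖ = ‖(z - w) + (w - a)‖ := by ring_nf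
          _ ≤ ‖z - w‖ + ‖w - a‖ := norm_add_le _ _
          _ ≤ D + ‖w - a‖ := by gcongr
      have h6 : ‖w - a‖ ≤ Real.exp v * ‖w - a‖ :=
        le_mul_of_one_le_left (norm_nonneg _) (Real.one_le_exp hv)
      have h7 := mul_le_mul_of_nonneg_left h3 hD0
      linarith
    calc ‖z - a‖ * ‖(s.map fun a => z - a).prod‖
        ≤ ((1 + D) * Real.exp v * ‖w - a‖) * _ :=
          mul_le_mul h4 (ih hs') (norm_nonneg _) (by positivity)
      _ = _ := by ring

/-- A Bernstein–Walsh inequality: polynomials bounded on a set of positive capacity grow at most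
geometrically in the degree on every bounded set. -/
theorem exists_norm_eval_le_pow_mul {A B : Set ℂ} (hA : IsCompact A) (hB : IsCompact B)
    (hcap : 0 < logCap A) :
    ∃ M : ℝ, 1 ≤ M ∧ ∀ (p : Polynomial ℂ) (m : ℝ), (∀ w ∈ A, ‖p.eval w‖ ≤ m) →
      ∀ z ∈ B, ‖p.eval z‖ ≤ M ^ p.natDegree * m := by
  obtain ⟨μ, S, K, hμ, hSA, hS0, hK, hint⟩ := exists_lintegral_logKernel_le hA hcap
  obtain ⟨D, hD⟩ := Metric.isBounded_iff.1 (hB.union hA).isBounded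
  set k : ℝ≥0∞ := K / μ S with hk
  have hktop : k ≠ ⊤ := ENNReal.div_ne_top hK hS0
  refine ⟨(1 + max D 0) * Real.exp k.toReal, ?_, fun p m hm z hz => ?_⟩
  · exact one_le_mul_of_one_le_of_one_le (by simp) (Real.one_le_exp ENNReal.toReal_nonneg)
  -- Averaging over `S` yields one point `w` that is good for all roots at once: the sum of their
  -- kernels is at most its mean, hence at most `K / μ S` per root.
  obtain ⟨w, hwS, hw⟩ := exists_le_setLAverage hS0 (measure_ne_top μ S)
    (measurable_sum_logKernel p.roots).aemeasurable
  rw [setLAverage_eq] at hw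
  have hcard : Multiset.card p.roots = p.natDegree :=
    (IsAlgClosed.splits p).natDegree_eq_card_roots.symm
  have hw2 : (p.roots.map fun a => logKernel a w).sum ≤ p.natDegree * k := by
    refine hw.trans ?_
    rw [hk, ← mul_div_assoc, ← hcard]
    gcongr
    exact lintegral_sum_logKernel_le hint _
  have hntop : (p.natDegree : ℝ≥0∞) * k ≠ ⊤ := ENNReal.mul_ne_top (by simp) hktop
  have hsum_ne := ne_top_of_le_ne_top hntop hw2
  have hsum : ((p.roots.map fun a => logKernel a w).sum).toReal ≤ p.natDegree * k.toReal := by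
    have := ENNReal.toReal_mono hntop hw2
    simpa using this
  have hzw : dist z w ≤ max D 0 := (hD (Or.inl hz) (Or.inr (hSA hwS))).trans (le_max_left _ _)
  have hprod := norm_prod_le_of_logKernel hzw p.roots hsum_ne
  have hm' := hm w (hSA hwS)
  rw [(IsAlgClosed.splits p).eval_eq_prod_roots, norm_mul] at hm' ⊢
  rw [mul_pow, ← Real.exp_nat_mul]
  rw [hcard] at hprod
  calc ‖p.leadingCoeff‖ * ‖(p.roots.map fun a => z - a).prod‖
      ≤ ‖p.leadingCoeff‖ * ((1 + max D 0) ^ p.natDegree *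
          Real.exp (p.natDegree * k.toReal) * ‖(p.roots.map fun a => w - a).prod‖) := by
        refine mul_le_mul_of_nonneg_left (hprod.trans ?_) (norm_nonneg _)
        gcongr
    _ = (1 + max D 0) ^ p.natDegree * Real.exp (p.natDegree * k.toReal) *
          (‖p.leadingCoeff‖ * ‖(p.roots.map fun a => w - a).prod‖) := by ring
    _ ≤ _ := by gcongr

section SupNorm

variable {E : Set ℂ} {f : ℂ → ℂ}

lemma supNorm_nonneg (E : Set ℂ) (f : ℂ → ℂ) : 0 ≤ supNorm E f :=
  Real.iSup_nonneg fun _ => norm_nonneg _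

lemma supNorm_le {C : ℝ} (hC : 0 ≤ C) (h : ∀ z ∈ E, ‖f z‖ ≤ C) : supNorm E f ≤ C :=
  Real.iSup_le (fun z => h z z.2) hC

lemma norm_le_supNorm (hE : IsCompact E) (hf : ContinuousOn f E) {z : ℂ} (hz : z ∈ E) :
    ‖f z‖ ≤ supNorm E f := by
  obtain ⟨C, hC⟩ := hE.exists_bound_of_continuousOn hf
  exact le_ciSup (f := fun z : E => ‖f z‖) ⟨C, by rintro _ ⟨w, rfl⟩; exact hC w w.2⟩ ⟨z, hz⟩

end SupNorm

/-! ### Continuous logarithms and polynomial convexity -/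

/-- The function `z - a` has a continuous logarithm on `A`. -/
def HasContinuousLog (A : Set ℂ) (a : ℂ) : Prop :=
  ∃ g : ℂ → ℂ, ContinuousOn g A ∧ ∀ z ∈ A, Complex.exp (g z) = z - a

/-- Factor `z - b = (z - a) * (1 - (b - a) / (z - a))`; the last factor lies in the unit disc about
`1`, where the principal logarithm is continuous. -/
lemma HasContinuousLog.of_near {A : Set ℂ} {a b : ℂ} (h : HasContinuousLog A a)
    (hab : ∀ z ∈ A, ‖b - a‖ < ‖z - a‖) : HasContinuousLog A b := by
  obtain ⟨g, hg, hexp⟩ := h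
  have hne : ∀ z ∈ A, z - a ≠ 0 := fun z hz =>
    norm_pos_iff.1 ((norm_nonneg _).trans_lt (hab z hz))
  have hlt : ∀ z ∈ A, 1 + -((b - a) / (z - a)) ∈ Complex.slitPlane := by
    intro z hz
    refine Complex.mem_slitPlane_of_norm_lt_one ?_
    rw [norm_neg, norm_div, div_lt_one (norm_pos_iff.2 (hne z hz))]
    exact hab z hz
  refine ⟨fun z => g z + Complex.log (1 + -((b - a) / (z - a))), ?_, fun z hz => ?_⟩
  · refine hg.add (ContinuousOn.clog ?_ hlt)
    exact continuousOn_const.add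
      (continuousOn_const.div (continuousOn_id.sub continuousOn_const) hne).neg
  · have := hne z hz
    rw [Complex.exp_add, hexp z hz, Complex.exp_log (Complex.slitPlane_ne_zero (hlt z hz))]
    field_simp
    ring

lemma hasContinuousLog_of_far {A : Set ℂ} {a : ℂ} (ha : a ≠ 0) (h : ∀ z ∈ A, ‖z‖ < ‖a‖) :
    HasContinuousLog A a := by
  have hlt : ∀ z ∈ A, 1 + -(z / a) ∈ Complex.slitPlane := by
    intro z hz
    refine Complex.mem_slitPlane_of_norm_lt_one ?_
    rw [norm_neg, norm_div, div_lt_one (norm_pos_iff.2 ha)]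
    exact h z hz
  refine ⟨fun z => Complex.log (-a) + Complex.log (1 + -(z / a)), ?_, fun z hz => ?_⟩
  · refine continuousOn_const.add (ContinuousOn.clog ?_ hlt)
    exact (continuous_const.add (continuous_id.div_const a).neg).continuousOn
  · rw [Complex.exp_add, Complex.exp_log (neg_ne_zero.2 ha),
      Complex.exp_log (Complex.slitPlane_ne_zero (hlt z hz))]
    field_simp
    ring

lemma exists_ball_dist_lt {A : Set ℂ} (hA : IsClosed A) {a : ℂ} (ha : a ∉ A) :
    ∃ r > 0, ∀ b ∈ Metric.ball a r, b ∉ A ∧ ∀ z ∈ A, ‖b - a‖ < ‖z - a‖ ∧ ‖a - b‖ < ‖z - b‖ := by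
  obtain ⟨r, hr, hball⟩ := Metric.isOpen_iff.1 hA.isOpen_compl a ha
  refine ⟨r / 2, by positivity, fun b hb => ⟨?_, fun z hz => ?_⟩⟩
  · exact hball (Metric.ball_subset_ball (by linarith) hb)
  have h1 : r ≤ ‖z - a‖ := by
    by_contra! h
    exact hball (by rwa [Metric.mem_ball, dist_eq_norm]) hz
  rw [Metric.mem_ball, dist_eq_norm] at hb
  have h2 : ‖z - a‖ ≤ ‖z - b‖ + ‖b - a‖ := by
    calc ‖z - a‖ = ‖(z - b) + (b - a)‖ := by ring_nf
      _ ≤ _ := norm_add_le _ _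
  have h3 := norm_sub_rev a b
  constructor <;> linarith

/-- Off a polynomially convex compact set `A`, all functions `z - a` have continuous logarithms
on `A`. -/
theorem PolyConvex.hasContinuousLog {A : Set ℂ} (hA : IsCompact A) (hconv : PolyConvex A) {a : ℂ}
    (ha : a ∉ A) : HasContinuousLog A a := by
  by_contra hcon
  -- Off `A`, having a logarithm is an open and closed condition on `b`, and it holds near infinity.
  -- So `U` is bounded and open with frontier in `A`, and the maximum principle puts `U` in the
  -- polynomial hull of `A`.
  set U : Set ℂ := {b | b ∉ A ∧ ¬ HasContinuousLog A b} with hU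
  have hUo : IsOpen U := by
    refine Metric.isOpen_iff.2 fun b hb => ?_
    obtain ⟨r, hr, h⟩ := exists_ball_dist_lt hA.isClosed hb.1
    exact ⟨r, hr, fun c hc => ⟨(h c hc).1, fun hlog =>
      hb.2 (hlog.of_near fun z hz => ((h c hc).2 z hz).2)⟩⟩
  have hUA : IsClosed (U ∪ A) := by
    rw [← isOpen_compl_iff]
    refine Metric.isOpen_iff.2 fun b hb => ?_
    have hbA : b ∉ A := fun h => hb (Or.inr h)
    have hblog : HasContinuousLog A b := by
      by_contra h
      exact hb (Or.inl ⟨hbA, h⟩)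
    obtain ⟨r, hr, h⟩ := exists_ball_dist_lt hA.isClosed hbA
    refine ⟨r, hr, fun c hc => ?_⟩
    rintro (hcU | hcA)
    · exact hcU.2 (hblog.of_near fun z hz => ((h c hc).2 z hz).1)
    · exact (h c hc).1 hcA
  have hUb : Bornology.IsBounded U := by
    obtain ⟨R, hR⟩ := hA.isBounded.exists_norm_le
    refine (Metric.isBounded_closedBall (x := (0 : ℂ)) (r := max R 0)).subset fun b hb => ?_
    rw [mem_closedBall_zero_iff]
    by_contra! h
    refine hb.2 (hasContinuousLog_of_far ?_ fun z hz => ?_)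
    · exact norm_pos_iff.1 ((le_max_right R 0).trans_lt h)
    · exact ((hR z hz).trans (le_max_left R 0)).trans_lt h
  have hfr : frontier U ⊆ A := by
    intro z hz
    rw [hUo.frontier_eq] at hz
    have := closure_minimal (Set.subset_union_left (t := A)) hUA hz.1
    exact this.resolve_left hz.2
  refine ha (hconv ▸ fun p => ?_)
  have haU : a ∈ U := ⟨ha, hcon⟩
  refine Complex.norm_le_of_forall_mem_frontier_norm_le hUb (f := fun z => p.eval z)
    p.differentiable.diffContOnCl (fun z hz => ?_) (subset_closure haU)
  exact norm_le_supNorm hA p.continuous.continuousOn (hfr hz)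

/-- The exponential covers `ℂ \ {0}`, and maps from the simply connected plane lift. -/
lemma exists_continuous_log {F : ℂ → ℂ} (hF : Continuous F) (h0 : ∀ z, F z ≠ 0) :
    ∃ G : ℂ → ℂ, Continuous G ∧ ∀ z, Complex.exp (G z) = F z := by
  let f : C(ℂ, {z : ℂ // z ≠ 0}) := ⟨fun z => ⟨F z, h0 z⟩, by fun_prop⟩
  obtain ⟨G, ⟨-, hG⟩, -⟩ := Complex.isCoveringMap_exp.existsUnique_continuousMap_lifts f 0
    (Complex.log (F 0)) (Subtype.ext (Complex.exp_log (h0 0)))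
  exact ⟨G, G.continuous, fun z => congrArg Subtype.val (congrFun hG z)⟩

/-- There is no continuous logarithm of `z - a` on a neighbourhood of infinity. -/
lemma not_exists_continuous_log_near_infty (a : ℂ) (R : ℝ) :
    ¬ ∃ G : ℂ → ℂ, Continuous G ∧ ∀ z, R ≤ ‖z‖ → Complex.exp (G z) = z - a := by
  rintro ⟨G, hG, hexp⟩
  set ρ : ℝ := |R| + ‖a‖ + 1
  have hρ : 0 < ρ := by positivity
  have hnorm : ∀ θ : ℝ, R ≤ ‖a + ρ * Complex.exp (θ * Complex.I)‖ := by
    intro θ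
    have h1 := norm_sub_norm_le (ρ * Complex.exp (θ * Complex.I)) (-a)
    rw [norm_mul, Complex.norm_exp_ofReal_mul_I, norm_neg, Complex.norm_of_nonneg hρ.le,
      sub_neg_eq_add, add_comm _ a] at h1
    have := le_abs_self R
    simp only [ρ] at h1 ⊢
    linarith
  -- On the circle `k` is continuous with integer values, hence constant; but `G` returns to its
  -- value after one turn while `θ` has grown by `2π`.
  let k : ℝ → ℂ := fun θ =>
    (G (a + ρ * Complex.exp (θ * Complex.I)) - θ * Complex.I - Real.log ρ) /
      (2 * Real.pi * Complex.I)
  have hk : Continuous k := by fun_prop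
  have hpi : (2 * Real.pi * Complex.I : ℂ) ≠ 0 := Complex.two_pi_I_ne_zero
  have hint : ∀ θ, ∃ n : ℤ, k θ = n := by
    intro θ
    have h1 := hexp _ (hnorm θ)
    have h2 : Complex.exp (G (a + ρ * Complex.exp (θ * Complex.I))) =
        Complex.exp (Real.log ρ + θ * Complex.I) := by
      rw [h1, Complex.exp_add, ← Complex.ofReal_exp, Real.exp_log hρ]
      ring
    obtain ⟨n, hn⟩ := Complex.exp_eq_exp_iff_exists_int.1 h2
    refine ⟨n, ?_⟩
    simp only [k]
    rw [div_eq_iff hpi, hn]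
    ring
  have hround : ∀ θ, k θ = (round (k θ).re : ℤ) := by
    intro θ
    obtain ⟨n, hn⟩ := hint θ
    rw [hn]
    simp
  have hconst : ∀ x y : ℝ, round (k x).re = round (k y).re := by
    intro x y
    have hloc : IsLocallyConstant fun θ => round (k θ).re := by
      rw [IsLocallyConstant.iff_eventually_eq]
      intro x
      filter_upwards [hk.continuousAt.eventually (Metric.ball_mem_nhds (k x) one_pos)] with y hy
      replace hy : dist (k y) (k x) < 1 := hy
      rw [hround y, hround x, Complex.dist_eq] at hy
      have h3 : |((round (k y).re - round (k x).re : ℤ) : ℝ)| < 1 := by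
        rw [← Complex.norm_intCast]
        push_cast
        exact_mod_cast hy
      have h4 : |round (k y).re - round (k x).re| < 1 := by exact_mod_cast h3
      have := Int.abs_lt_one_iff.1 h4
      omega
    exact hloc.apply_eq_of_isPreconnected isPreconnected_univ (Set.mem_univ x) (Set.mem_univ y)
  have h01 : k 0 = k (2 * Real.pi) := by
    rw [hround 0, hround (2 * Real.pi), hconst 0 (2 * Real.pi)]
  simp only [k] at h01
  rw [div_left_inj' hpi] at h01
  have hper : Complex.exp (((2 * Real.pi : ℝ) : ℂ) * Complex.I) = 1 := by
    rw [Complex.ofReal_mul]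
    exact_mod_cast Complex.exp_two_pi_mul_I
  rw [hper] at h01
  simp only [Complex.ofReal_zero, zero_mul, Complex.exp_zero, sub_zero, Complex.ofReal_mul,
    Complex.ofReal_ofNat] at h01
  apply hpi
  linear_combination h01

/-- An open bounded set `Ω` with `Ω ∪ E` closed is contained in `E` as soon as all `z - a`,
`a ∉ E`, have continuous logarithms on `E`. -/
lemma false_of_hasContinuousLog {E Ω : Set ℂ} (hE : IsClosed E) (hΩ : IsOpen Ω)
    (hΩb : Bornology.IsBounded Ω) (hΩE : IsClosed (Ω ∪ E)) {a : ℂ} (haΩ : a ∈ Ω)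
    (hdisj : Disjoint Ω E) (hlog : HasContinuousLog E a) : False := by
  classical
  obtain ⟨g, hg, hexp⟩ := hlog
  -- Tietze extends the logarithm over `Ω`. Replacing `z - a` by `exp g'` inside `Ω` removes its
  -- only zero, so the new function has a global logarithm, although it still equals `z - a` near
  -- infinity.
  obtain ⟨g', hg'⟩ := ContinuousMap.exists_restrict_eq hE ⟨E.domRestrict g, hg.domRestrict⟩
  have hgE : ∀ z ∈ E, g' z = g z := fun z hz => congrArg (fun h : C(E, ℂ) => h ⟨z, hz⟩) hg'
  set F : ℂ → ℂ := fun z => if z ∈ Ω then Complex.exp (g' z) else z - a with hFdef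
  have hF1 : Set.EqOn F (fun z => Complex.exp (g' z)) (Ω ∪ E) := by
    rintro z (hz | hz)
    · simp [hFdef, hz]
    · have : z ∉ Ω := fun h => hdisj.le_bot ⟨h, hz⟩
      simp [hFdef, this, hgE z hz, hexp z hz]
  have hF2 : Set.EqOn F (fun z => z - a) Ωᶜ := by
    intro z hz
    have : z ∉ Ω := hz
    simp [hFdef, this]
  have hF : Continuous F := by
    rw [← continuousOn_univ]
    have hu : (Ω ∪ E) ∪ Ωᶜ = Set.univ := by
      rw [Set.union_right_comm, Set.union_compl_self, Set.univ_union]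
    rw [← hu]
    refine ContinuousOn.union_of_isClosed ?_ ?_ hΩE hΩ.isClosed_compl
    · exact ContinuousOn.congr (by fun_prop) hF1
    · exact ContinuousOn.congr (by fun_prop) hF2
  have hF0 : ∀ z, F z ≠ 0 := by
    intro z
    by_cases hz : z ∈ Ω
    · simp [hFdef, hz, Complex.exp_ne_zero]
    · simp only [hFdef, hz, if_false]
      intro h
      rw [sub_eq_zero.1 h] at hz
      exact hz haΩ
  obtain ⟨G, hG, hGF⟩ := exists_continuous_log hF hF0
  obtain ⟨R, hR⟩ := hΩb.exists_norm_le
  refine not_exists_continuous_log_near_infty a (R + 1) ⟨G, hG, fun z hz => ?_⟩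
  rw [hGF, hF2]
  intro hzΩ
  have := hR z hzΩ
  linarith

/-! ### The spectrum of the coordinate function -/

/-- The uniform closure on `E` of the polynomials. -/
noncomputable abbrev polyAlgebra (E : Set ℂ) [CompactSpace E] : Subalgebra ℂ C(E, ℂ) :=
  (polynomialFunctions E).topologicalClosure

noncomputable instance (E : Set ℂ) [CompactSpace E] : CompleteSpace (polyAlgebra E) :=
  (polynomialFunctions E).isClosed_topologicalClosure.completeSpace_coe

instance (E : Set ℂ) [CompactSpace E] : IsClosed (polyAlgebra E : Set C(E, ℂ)) :=
  (polynomialFunctions E).isClosed_topologicalClosure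

/-- The coordinate function in `polyAlgebra E`. -/
noncomputable def coord (E : Set ℂ) [CompactSpace E] : polyAlgebra E :=
  ⟨Polynomial.X.toContinuousMapOn E, (polynomialFunctions E).le_topologicalClosure
    ⟨Polynomial.X, trivial, rfl⟩⟩

lemma coord_apply (E : Set ℂ) [CompactSpace E] (z : E) : (coord E : C(E, ℂ)) z = z := by
  simp [coord]

/-- Passing from `C(E, ℂ)`, where the spectrum is `E`, to a closed subalgebra can only fill holes:
the frontier of the new spectrum lies in the old one. A filled hole is excluded by
`false_of_hasContinuousLog`. -/
lemma not_mem_spectrum_coord {E : Set ℂ} [CompactSpace E]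
    (hlog : ∀ a ∉ E, HasContinuousLog E a) {a : ℂ} (ha : a ∉ E) :
    a ∉ spectrum ℂ (coord E) := by
  have hE : IsClosed E := (isCompact_iff_compactSpace.2 ‹_›).isClosed
  intro hσ
  have hspec : spectrum ℂ (coord E : C(E, ℂ)) ⊆ E := by
    intro b hb
    rw [ContinuousMap.spectrum_eq_range] at hb
    obtain ⟨z, rfl⟩ := hb
    rw [coord_apply]
    exact z.2
  have hfr := Subalgebra.frontier_spectrum (𝕜 := ℂ) (polyAlgebra E) (coord E)
  have hclosed := spectrum.isClosed (𝕜 := ℂ) (coord E)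
  have hEσ : E ⊆ spectrum ℂ (coord E) := by
    intro z hz
    have h1 : spectrum ℂ (coord E : C(E, ℂ)) ⊆ spectrum ℂ (coord E) :=
      spectrum.subset_subalgebra (coord E)
    refine h1 ?_
    rw [ContinuousMap.spectrum_eq_range]
    exact ⟨⟨z, hz⟩, coord_apply E _⟩
  refine false_of_hasContinuousLog (Ω := spectrum ℂ (coord E) \ E) hE ?_ ?_ ?_ ⟨hσ, ha⟩
    Set.disjoint_sdiff_left (hlog a ha)
  · rw [isOpen_iff_mem_nhds]
    intro b hb
    have hbi : b ∈ interior (spectrum ℂ (coord E)) := by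
      by_contra h
      exact hb.2 (hspec (hfr ⟨subset_closure hb.1, h⟩))
    exact inter_mem (mem_interior_iff_mem_nhds.1 hbi) (hE.isOpen_compl.mem_nhds hb.2)
  · exact (spectrum.isBounded (𝕜 := ℂ) (coord E)).subset Set.sdiff_subset
  · rw [Set.sdiff_union_of_subset hEσ]
    exact hclosed

lemma HasContinuousLog.union {A B : Set ℂ} (hA : IsClosed A) (hB : IsClosed B)
    (hAB : Disjoint A B) {a : ℂ} (h1 : HasContinuousLog A a) (h2 : HasContinuousLog B a) :
    HasContinuousLog (A ∪ B) a := by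
  classical
  obtain ⟨g, hg, hge⟩ := h1
  obtain ⟨h, hh, hhe⟩ := h2
  have e1 : Set.EqOn (A.piecewise g h) g A := A.piecewise_eqOn g h
  have e2 : Set.EqOn (A.piecewise g h) h B :=
    (A.piecewise_eqOn_compl g h).mono hAB.symm.subset_compl_right
  refine ⟨A.piecewise g h, (hg.congr e1).union_of_isClosed (hh.congr e2) hA hB, ?_⟩
  rintro z (hz | hz)
  · rw [e1 hz, hge z hz]
  · rw [e2 hz, hhe z hz]

/-! ### Integrals over squares and the Cauchy–Pompeiu formula -/

open Complex in
/-- The integral of `f` over the positively oriented boundary of the square `[-R, R]²`. -/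
noncomputable def squareIntegral (R : ℝ) (f : ℂ → ℂ) : ℂ :=
  (∫ x : ℝ in (-R)..R, f (x + (-R : ℝ) * I)) - (∫ x : ℝ in (-R)..R, f (x + R * I)) +
    I • (∫ y : ℝ in (-R)..R, f (R + y * I)) - I • ∫ y : ℝ in (-R)..R, f ((-R : ℝ) + y * I)

section Square

open Complex

variable {R : ℝ}

lemma le_norm_add_neg_mul_I (hR : 0 ≤ R) (x : ℝ) : R ≤ ‖(x + (-R : ℝ) * I : ℂ)‖ := by
  have := abs_im_le_norm (x + (-R : ℝ) * I : ℂ)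
  simpa [abs_of_nonneg hR] using this

lemma le_norm_add_mul_I (hR : 0 ≤ R) (x : ℝ) : R ≤ ‖(x + R * I : ℂ)‖ := by
  have := abs_im_le_norm (x + R * I : ℂ)
  simpa [abs_of_nonneg hR] using this

lemma le_norm_ofReal_add (hR : 0 ≤ R) (y : ℝ) : R ≤ ‖(R + y * I : ℂ)‖ := by
  have := abs_re_le_norm (R + y * I : ℂ)
  simpa [abs_of_nonneg hR] using this

lemma le_norm_neg_ofReal_add (hR : 0 ≤ R) (y : ℝ) : R ≤ ‖((-R : ℝ) + y * I : ℂ)‖ := by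
  have := abs_re_le_norm ((-R : ℝ) + y * I : ℂ)
  simpa [abs_of_nonneg hR] using this

lemma squareIntegral_congr {f g : ℂ → ℂ} (hR : 0 ≤ R) (h : ∀ w, R ≤ ‖w‖ → f w = g w) :
    squareIntegral R f = squareIntegral R g := by
  simp only [squareIntegral, h _ (le_norm_add_neg_mul_I hR _), h _ (le_norm_add_mul_I hR _),
    h _ (le_norm_ofReal_add hR _), h _ (le_norm_neg_ofReal_add hR _)]

lemma squareIntegral_const_mul (c : ℂ) (f : ℂ → ℂ) :
    squareIntegral R (fun w => c * f w) = c * squareIntegral R f := by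
  simp only [squareIntegral, intervalIntegral.integral_const_mul, smul_eq_mul]
  ring

lemma integral_horizontal {L h : ℂ → ℂ} {c : ℂ} {S : Set ℂ} (hc : ∀ x : ℝ, x + c ∈ S)
    (hL : ∀ w ∈ S, HasDerivAt L (h w) w) (hh : ContinuousOn h S) (a b : ℝ) :
    ∫ x : ℝ in a..b, h (x + c) = L (b + c) - L (a + c) := by
  refine intervalIntegral.integral_eq_sub_of_hasDerivAt (f := fun x : ℝ => L (x + c))
    (fun x _ => ?_) (Continuous.intervalIntegrable ?_ _ _)
  · have h1 := (hL _ (hc x)).comp_of_eq x ((hasDerivAt_id x).ofReal_comp.add_const c) rfl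
    rw [ofReal_one, mul_one] at h1
    exact h1
  · exact hh.comp_continuous (by fun_prop) hc

lemma integral_vertical {L h : ℂ → ℂ} {c : ℂ} {S : Set ℂ} (hc : ∀ y : ℝ, c + y * I ∈ S)
    (hL : ∀ w ∈ S, HasDerivAt L (h w) w) (hh : ContinuousOn h S) (a b : ℝ) :
    I • ∫ y : ℝ in a..b, h (c + y * I) = L (c + b * I) - L (c + a * I) := by
  rw [← intervalIntegral.integral_smul]
  refine intervalIntegral.integral_eq_sub_of_hasDerivAt (f := fun y : ℝ => L (c + y * I))
    (fun x _ => ?_) (Continuous.intervalIntegrable ?_ _ _)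
  · have h1 : HasDerivAt (fun y : ℝ => c + y * I) ((1 : ℝ) * I) x :=
      ((hasDerivAt_id x).ofReal_comp.mul_const I).const_add c
    have h2 := (hL _ (hc x)).comp_of_eq x h1 rfl
    rw [ofReal_one, one_mul, mul_comm] at h2
    exact h2
  · exact (hh.comp_continuous (by fun_prop) hc).const_smul I

lemma squareIntegral_eq_zero {L h : ℂ → ℂ} (hR : 0 ≤ R)
    (hL : ∀ w ∈ {w : ℂ | R ≤ ‖w‖}, HasDerivAt L (h w) w)
    (hh : ContinuousOn h {w : ℂ | R ≤ ‖w‖}) : squareIntegral R h = 0 := by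
  rw [squareIntegral, integral_horizontal (le_norm_add_neg_mul_I hR) hL hh,
    integral_horizontal (le_norm_add_mul_I hR) hL hh,
    integral_vertical (le_norm_ofReal_add hR) hL hh,
    integral_vertical (le_norm_neg_ofReal_add hR) hL hh]
  ring

lemma squareIntegral_sub {f g : ℂ → ℂ} (hR : 0 ≤ R) (hf : ContinuousOn f {w : ℂ | R ≤ ‖w‖})
    (hg : ContinuousOn g {w : ℂ | R ≤ ‖w‖}) :
    squareIntegral R (fun w => f w - g w) = squareIntegral R f - squareIntegral R g := by
  have h1 : ∀ {f : ℂ → ℂ}, ContinuousOn f {w : ℂ | R ≤ ‖w‖} → ∀ {u : ℝ → ℂ}, Continuous u →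
      (∀ x, R ≤ ‖u x‖) → IntervalIntegrable (fun x => f (u x)) volume (-R) R :=
    fun hf _ hu hn => (hf.comp_continuous hu hn).intervalIntegrable _ _
  simp only [squareIntegral]
  rw [intervalIntegral.integral_sub (h1 hf (by fun_prop) (le_norm_add_neg_mul_I hR))
      (h1 hg (by fun_prop) (le_norm_add_neg_mul_I hR)),
    intervalIntegral.integral_sub (h1 hf (by fun_prop) (le_norm_add_mul_I hR))
      (h1 hg (by fun_prop) (le_norm_add_mul_I hR)),
    intervalIntegral.integral_sub (h1 hf (by fun_prop) (le_norm_ofReal_add hR))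
      (h1 hg (by fun_prop) (le_norm_ofReal_add hR)),
    intervalIntegral.integral_sub (h1 hf (by fun_prop) (le_norm_neg_ofReal_add hR))
      (h1 hg (by fun_prop) (le_norm_neg_ofReal_add hR))]
  simp only [smul_eq_mul]
  ring

/-- The difference of the integrands has the primitive `log (1 - z / w)`, single-valued for `|w| >
|z|`. -/
lemma squareIntegral_inv_sub {z : ℂ} (hz : ‖z‖ < R) :
    squareIntegral R (fun w => (w - z)⁻¹) = squareIntegral R (fun w => w⁻¹) := by
  have hR : 0 < R := (norm_nonneg z).trans_lt hz
  have hw0 : ∀ w ∈ {w : ℂ | R ≤ ‖w‖}, w ≠ 0 := fun w hw =>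
    norm_pos_iff.1 (hR.trans_le hw)
  have hwz : ∀ w ∈ {w : ℂ | R ≤ ‖w‖}, w - z ≠ 0 := by
    intro w hw h
    rw [sub_eq_zero.1 h] at hw
    exact absurd hz (not_lt.2 hw)
  have hc1 : ContinuousOn (fun w : ℂ => (w - z)⁻¹) {w : ℂ | R ≤ ‖w‖} :=
    (continuousOn_id.sub continuousOn_const).inv₀ hwz
  have hc2 : ContinuousOn (fun w : ℂ => w⁻¹) {w : ℂ | R ≤ ‖w‖} := continuousOn_id.inv₀ hw0
  rw [← sub_eq_zero, ← squareIntegral_sub hR.le hc1 hc2]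
  refine squareIntegral_eq_zero (L := fun w => log (1 + -(z * w⁻¹))) hR.le (fun w hw => ?_)
    (hc1.sub hc2)
  have h0 := hw0 w hw
  have h1 := hwz w hw
  have hslit : 1 + -(z * w⁻¹) ∈ slitPlane := by
    refine mem_slitPlane_of_norm_lt_one ?_
    rw [norm_neg, ← div_eq_mul_inv, norm_div, div_lt_one (norm_pos_iff.2 h0)]
    exact hz.trans_le hw
  refine (((((hasDerivAt_inv h0).const_mul z).neg).const_add 1).clog hslit).congr_deriv ?_
  have h3 : 1 + -(z * w⁻¹) = (w - z) / w := by field_simp; ring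
  change -(z * -(w ^ 2)⁻¹) / (1 + -(z * w⁻¹)) = _
  rw [h3]
  field_simp
  ring

/-- Opposite sides combine to multiples of one positive real integral. Only nonvanishing is needed,
so the value `2πi` is not computed. -/
lemma squareIntegral_inv_ne_zero (hR : 0 < R) : squareIntegral R (fun w => w⁻¹) ≠ 0 := by
  have hden : ∀ x : ℝ, x ^ 2 + R ^ 2 ≠ 0 := fun x => by positivity
  have hne : ∀ {w : ℂ}, R ≤ ‖w‖ → w ≠ 0 := fun hw => norm_pos_iff.1 (hR.trans_le hw)
  have n1 := fun x => hne (le_norm_add_neg_mul_I hR.le x)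
  have n2 := fun x => hne (le_norm_add_mul_I hR.le x)
  have n3 := fun x => hne (le_norm_ofReal_add hR.le x)
  have n4 := fun x => hne (le_norm_neg_ofReal_add hR.le x)
  have key : squareIntegral R (fun w => w⁻¹) =
      4 * I * ((∫ x : ℝ in (-R)..R, R / (x ^ 2 + R ^ 2) : ℝ) : ℂ) := by
    have e1 : ∀ x : ℝ, ((x + (-R : ℝ) * I : ℂ))⁻¹ - ((x + R * I : ℂ))⁻¹ =
        2 * I * ((R / (x ^ 2 + R ^ 2) : ℝ) : ℂ) := by
      intro x
      have a1 := n1 x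
      have a2 := n2 x
      have hmul : (x + (-R : ℝ) * I : ℂ) * (x + R * I) = (x : ℂ) ^ 2 + (R : ℂ) ^ 2 := by
        push_cast
        linear_combination (-(R : ℂ) ^ 2) * I_sq
      rw [inv_sub_inv a1 a2, hmul]
      push_cast
      ring
    have e2 : ∀ y : ℝ, ((R + y * I : ℂ))⁻¹ - (((-R : ℝ) + y * I : ℂ))⁻¹ =
        2 * ((R / (y ^ 2 + R ^ 2) : ℝ) : ℂ) := by
      intro y
      have a1 := n3 y
      have a2 := n4 y
      have hmul : (R + y * I : ℂ) * ((-R : ℝ) + y * I) = -((y : ℂ) ^ 2 + (R : ℂ) ^ 2) := by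
        push_cast
        linear_combination (y : ℂ) ^ 2 * I_sq
      rw [inv_sub_inv a1 a2, hmul, div_neg]
      push_cast
      ring
    rw [squareIntegral, ← intervalIntegral.integral_sub, add_sub_assoc, ← smul_sub,
      ← intervalIntegral.integral_sub]
    · simp only [e1, e2, intervalIntegral.integral_const_mul, intervalIntegral.integral_ofReal,
        smul_eq_mul]
      ring
    all_goals exact (Continuous.inv₀ (by fun_prop) (by assumption)).intervalIntegrable _ _
  rw [key]
  have hpos : 0 < ∫ x : ℝ in (-R)..R, R / (x ^ 2 + R ^ 2) := by
    refine intervalIntegral.intervalIntegral_pos_of_pos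
      (Continuous.intervalIntegrable ?_ _ _) (fun x => by positivity) (by linarith)
    exact continuous_const.div (by fun_prop) hden
  have : ((∫ x : ℝ in (-R)..R, R / (x ^ 2 + R ^ 2) : ℝ) : ℂ) ≠ 0 := ofReal_ne_zero.2 hpos.ne'
  simp [this]

end Square

open Complex in
/-- The operator `2i ∂/∂z̄`. -/
noncomputable def dbar (f : ℂ → ℂ) (w : ℂ) : ℂ :=
  I • fderiv ℝ f w 1 - fderiv ℝ f w I

lemma continuous_dbar {f : ℂ → ℂ} (hf : ContDiff ℝ 1 f) : Continuous (dbar f) := by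
  have h := hf.continuous_fderiv one_ne_zero
  exact ((h.clm_apply continuous_const).const_smul Complex.I).sub (h.clm_apply continuous_const)

lemma dbar_eq_zero {f : ℂ → ℂ} {w c : ℂ} (h : f =ᶠ[𝓝 w] fun _ => c) : dbar f w = 0 := by
  simp [dbar, h.fderiv_eq]

lemma squareIntegral_eq_integral_dbar {f : ℂ → ℂ} (hf : ContDiff ℝ 1 f) (R : ℝ) :
    squareIntegral R f =
      ∫ x : ℝ in (-R)..R, ∫ y : ℝ in (-R)..R, dbar f (x + y * Complex.I) := by
  have h := Complex.integral_boundary_rect_of_differentiableOn_real f ⟨-R, -R⟩ ⟨R, R⟩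
    (hf.differentiable one_ne_zero).differentiableOn
    ((continuous_dbar hf).continuousOn.integrableOn_compact
      (isCompact_uIcc.reProdIm isCompact_uIcc))
  exact h

/-- A Cauchy–Pompeiu formula on the square `[-R, R]²` at points near which `φ` is constant. -/
lemma integral_dbar_div_sub {φ : ℂ → ℂ} (hφ : ContDiff ℝ 1 φ) {R : ℝ}
    (hR : ∀ w, R ≤ ‖w‖ → φ w = 0) {z : ℂ} (hz : ‖z‖ < R) (hloc : φ =ᶠ[𝓝 z] fun _ => φ z) :
    ∫ x : ℝ in (-R)..R, ∫ y : ℝ in (-R)..R,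
        dbar φ (x + y * Complex.I) * ((x + y * Complex.I : ℂ) - z)⁻¹ =
      -squareIntegral R (fun w => w⁻¹) * φ z := by
  -- Because `φ` is constant near `z`, this quotient vanishes there and is `C¹` everywhere, so
  -- Green's formula applies without excising a disc.
  set F : ℂ → ℂ := fun w => (φ w - φ z) * (w - z)⁻¹ with hFdef
  have hR0 : 0 < R := (norm_nonneg z).trans_lt hz
  have hFloc : F =ᶠ[𝓝 z] fun _ => 0 := by
    filter_upwards [hloc] with w hw
    simp [hFdef, hw]
  have hF : ContDiff ℝ 1 F := by
    rw [contDiff_iff_contDiffAt]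
    intro w
    rcases eq_or_ne w z with rfl | hw
    · exact contDiffAt_const.congr_of_eventuallyEq hFloc
    · exact (hφ.contDiffAt.sub contDiffAt_const).mul
        ((contDiffAt_id.sub contDiffAt_const).inv (sub_ne_zero.2 hw))
  have hdb : ∀ w, dbar F w = dbar φ w * (w - z)⁻¹ := by
    intro w
    rcases eq_or_ne w z with rfl | hw
    · rw [dbar_eq_zero hFloc, dbar_eq_zero hloc, zero_mul]
    · have h1 : HasFDerivAt φ (fderiv ℝ φ w) w :=
        (hφ.differentiable one_ne_zero w).hasFDerivAt
      have hw' := sub_ne_zero.2 hw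
      have h2 : HasDerivAt (fun w : ℂ => (w - z)⁻¹) (-1 / (w - z) ^ 2) w :=
        ((hasDerivAt_id w).sub_const z).inv hw'
      have h3 := (h1.sub_const (φ z)).mul (h2.hasFDerivAt.restrictScalars ℝ)
      simp only [dbar]
      rw [show fderiv ℝ F w = _ from h3.fderiv]
      simp
      ring
  have hmain := squareIntegral_eq_integral_dbar hF R
  simp only [hdb] at hmain
  rw [← hmain, squareIntegral_congr hR0.le (g := fun w => -φ z * (w - z)⁻¹)
    (fun w hw => by simp [hFdef, hR w hw]), squareIntegral_const_mul, squareIntegral_inv_sub hz]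
  ring

/-! ### Cauchy integrals in the algebra and polynomial separation -/

/-- Evaluation at a point of `E` as a continuous linear functional on `polyAlgebra E`. -/
noncomputable def evalAt {E : Set ℂ} [CompactSpace E] (z : E) : polyAlgebra E →L[ℂ] ℂ :=
  (ContinuousMap.evalCLM ℂ z).comp (polyAlgebra E).toSubmodule.subtypeL

lemma evalAt_apply {E : Set ℂ} [CompactSpace E] (z : E) (f : polyAlgebra E) :
    evalAt z f = (f : C(E, ℂ)) z := rfl

lemma evalAt_resolvent {E : Set ℂ} [CompactSpace E] (z : E) {w : ℂ}
    (hw : w ∉ spectrum ℂ (coord E)) :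
    evalAt z (resolvent (coord E) w) = (w - z)⁻¹ := by
  have hu : IsUnit (algebraMap ℂ (polyAlgebra E) w - coord E) := by
    simpa [spectrum.mem_iff] using hw
  have h1 : resolvent (coord E) w * (algebraMap ℂ (polyAlgebra E) w - coord E) = 1 :=
    Ring.inverse_mul_cancel _ hu
  have h2 := congrArg (evalAt z) h1
  simp only [evalAt_apply] at h2 ⊢
  refine eq_inv_of_mul_eq_one_left ?_
  simpa [coord_apply] using h2

/-- Functions that are locally constant near `E` belong to `polyAlgebra E`, if the spectrum of the
coordinate function is `E`. -/
lemma exists_polyAlgebra_eq {E : Set ℂ} [CompactSpace E]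
    (hσ : ∀ a ∉ E, a ∉ spectrum ℂ (coord E)) {φ : ℂ → ℂ} (hφ : ContDiff ℝ 1 φ) {R : ℝ}
    (hR0 : 0 < R) (hR : ∀ w, R ≤ ‖w‖ → φ w = 0) (hER : ∀ z ∈ E, ‖z‖ < R)
    (hloc : ∀ z ∈ E, φ =ᶠ[𝓝 z] fun _ => φ z) :
    ∃ T : polyAlgebra E, ∀ z : E, (T : C(E, ℂ)) z = φ z := by
  set k : ℂ → polyAlgebra E := fun w => dbar φ w • resolvent (coord E) w with hk
  -- The resolvent is uncontrolled on `E`, but `dbar φ` vanishes in a neighbourhood of `E`.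
  have hkc : Continuous k := by
    rw [continuous_iff_continuousAt]
    intro w
    by_cases hw : w ∈ E
    · have h0 : k =ᶠ[𝓝 w] fun _ => 0 := by
        filter_upwards [(hloc w hw).eventually_nhds] with v hv
        simp [hk, dbar_eq_zero hv]
      exact continuousAt_const.congr h0.symm
    · exact (continuous_dbar hφ).continuousAt.smul
        (spectrum.hasDerivAt_resolvent_const_left (not_not.1 (hσ w hw))).continuousAt
  have hk2 : Continuous fun p : ℝ × ℝ => k (p.1 + p.2 * Complex.I) := by
    exact hkc.comp (by fun_prop)
  have heval : ∀ (z : E) (w : ℂ), evalAt z (k w) = dbar φ w * (w - z)⁻¹ := by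
    intro z w
    by_cases hw : w ∈ E
    · simp [hk, dbar_eq_zero (hloc w hw)]
    · simp only [hk, map_smul, evalAt_resolvent z (hσ w hw), smul_eq_mul]
  have hJ := squareIntegral_inv_ne_zero hR0
  refine ⟨(-squareIntegral R (fun w => w⁻¹))⁻¹ •
    ∫ x : ℝ in (-R)..R, ∫ y : ℝ in (-R)..R, k (x + y * Complex.I), fun z => ?_⟩
  rw [← evalAt_apply, map_smul, ← ContinuousLinearMap.intervalIntegral_comp_comm]
  · have : ∀ x : ℝ, evalAt z (∫ y : ℝ in (-R)..R, k (x + y * Complex.I)) =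
        ∫ y : ℝ in (-R)..R, dbar φ (x + y * Complex.I) * ((x + y * Complex.I : ℂ) - z)⁻¹ := by
      intro x
      rw [← ContinuousLinearMap.intervalIntegral_comp_comm]
      · simp only [heval]
      · exact (hk2.comp (by fun_prop : Continuous fun y : ℝ => (x, y))).intervalIntegrable _ _
    simp only [this]
    rw [integral_dbar_div_sub hφ hR (hER z z.2) (hloc z z.2), smul_eq_mul,
      inv_mul_cancel_left₀ (neg_ne_zero.2 hJ)]
  · exact (intervalIntegral.continuous_parametric_intervalIntegral_of_continuous'
      hk2 _ _).intervalIntegrable _ _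

open scoped Manifold ContDiff in
lemma exists_bump {A B : Set ℂ} (hA : IsCompact A) (hB : IsCompact B) (hAB : Disjoint A B)
    {R : ℝ} (hAR : ∀ z ∈ A, ‖z‖ < R) :
    ∃ φ : ℂ → ℂ, ContDiff ℝ 1 φ ∧ (∀ w, R ≤ ‖w‖ → φ w = 0) ∧
      (∀ z ∈ A, φ =ᶠ[𝓝 z] fun _ => 1) ∧ ∀ z ∈ B, φ =ᶠ[𝓝 z] fun _ => 0 := by
  have hdisj : Disjoint (B ∪ {w : ℂ | R ≤ ‖w‖}) A := by
    rw [Set.disjoint_union_left]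
    exact ⟨hAB.symm, Set.disjoint_left.2 fun z hz hzA => absurd (hAR z hzA) (not_lt.2 hz)⟩
  have hcl : IsClosed {w : ℂ | R ≤ ‖w‖} := isClosed_le continuous_const continuous_norm
  obtain ⟨f, hf0, hf1, -⟩ := exists_contMDiffMap_zero_one_nhds_of_isClosed (n := 1)
    (modelWithCornersSelf ℝ ℂ) (hB.isClosed.union hcl) hA.isClosed hdisj
  rw [eventually_nhdsSet_iff_forall] at hf0 hf1
  refine ⟨fun w => (f w : ℂ), ?_, fun w hw => ?_, fun z hz => ?_, fun z hz => ?_⟩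
  · exact Complex.ofRealCLM.contDiff.comp f.contMDiff.contDiff
  · simp [(hf0 w (Or.inr hw)).self_of_nhds]
  · filter_upwards [hf1 z hz] with w hw
    simp [hw]
  · filter_upwards [hf0 z (Or.inl hz)] with w hw
    simp [hw]

/-- Disjoint polynomially convex compact sets are separated by a polynomial. -/
theorem exists_polynomial_separating {A B : Set ℂ} (hA : IsCompact A) (hB : IsCompact B)
    (hAB : Disjoint A B) (hAconv : PolyConvex A) (hBconv : PolyConvex B) {ε : ℝ} (hε : 0 < ε) :
    ∃ q : Polynomial ℂ, (∀ z ∈ A, ‖1 - q.eval z‖ ≤ ε) ∧ ∀ z ∈ B, ‖q.eval z‖ ≤ ε := by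
  have hE : IsCompact (A ∪ B) := hA.union hB
  have : CompactSpace (A ∪ B : Set ℂ) := isCompact_iff_compactSpace.1 hE
  have hσ : ∀ a ∉ A ∪ B, a ∉ spectrum ℂ (coord (A ∪ B)) := fun a ha =>
    not_mem_spectrum_coord (E := A ∪ B) (fun b hb =>
      (hAconv.hasContinuousLog hA fun h => hb (Or.inl h)).union hA.isClosed hB.isClosed hAB
        (hBconv.hasContinuousLog hB fun h => hb (Or.inr h))) ha
  obtain ⟨R, hR⟩ := hE.isBounded.exists_norm_le
  have hER : ∀ z ∈ A ∪ B, ‖z‖ < max R 0 + 1 := fun z hz =>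
    ((hR z hz).trans (le_max_left R 0)).trans_lt (lt_add_one _)
  obtain ⟨φ, hφ, hφR, hφA, hφB⟩ := exists_bump hA hB hAB fun z hz => hER z (Or.inl hz)
  obtain ⟨T, hT⟩ := exists_polyAlgebra_eq (E := A ∪ B) hσ hφ (by positivity) hφR hER (by
    rintro z (hz | hz)
    · simpa [(hφA z hz).self_of_nhds] using hφA z hz
    · simpa [(hφB z hz).self_of_nhds] using hφB z hz)
  obtain ⟨g, ⟨q, -, rfl⟩, hg⟩ := Metric.mem_closure_iff.1 T.2 ε hε
  have hq : ∀ z (hz : z ∈ A ∪ B), ‖φ z - q.eval z‖ ≤ ε := by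
    intro z hz
    rw [← hT ⟨z, hz⟩]
    have h1 := ContinuousMap.dist_apply_le_dist (f := (T : C((A ∪ B : Set ℂ), ℂ)))
      (g := q.toContinuousMapOn (A ∪ B)) ⟨z, hz⟩
    rw [dist_eq_norm] at h1
    exact h1.trans hg.le
  refine ⟨q, fun z hz => ?_, fun z hz => ?_⟩
  · simpa [(hφA z hz).self_of_nhds] using hq z (Or.inl hz)
  · simpa [(hφB z hz).self_of_nhds] using hq z (Or.inr hz)

/-! ### Smoothstep polynomials -/

lemma norm_pow_mul_pow_le {u v : ℂ} {δ : ℝ} (hδ1 : δ ≤ 1) (hu : ‖u‖ ≤ δ) (hv : ‖v‖ ≤ 2)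
    {N a b : ℕ} (ha : N + 1 ≤ a) (hb : b ≤ N) : ‖u ^ a * v ^ b‖ ≤ δ ^ (N + 1) * 2 ^ N := by
  have hδ : 0 ≤ δ := (norm_nonneg u).trans hu
  rw [norm_mul, norm_pow, norm_pow]
  calc ‖u‖ ^ a * ‖v‖ ^ b ≤ δ ^ a * 2 ^ b := by gcongr
    _ ≤ δ ^ (N + 1) * 2 ^ N :=
      mul_le_mul (pow_le_pow_of_le_one hδ hδ1 ha) (pow_le_pow_right₀ one_le_two hb)
        (by positivity) (by positivity)

lemma norm_sum_choose_le {T : Finset ℕ} {n : ℕ} (hT : T ⊆ Finset.range (n + 1)) {t : ℕ → ℂ}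
    {c : ℝ} (hc : 0 ≤ c) (ht : ∀ j ∈ T, ‖t j‖ ≤ c) :
    ‖∑ j ∈ T, t j * (n.choose j : ℂ)‖ ≤ 2 ^ n * c := by
  calc ‖∑ j ∈ T, t j * (n.choose j : ℂ)‖ ≤ ∑ j ∈ T, c * (n.choose j : ℝ) := by
        refine norm_sum_le_of_le _ fun j hj => ?_
        rw [norm_mul, Complex.norm_natCast]
        gcongr
        exact ht j hj
    _ ≤ ∑ j ∈ Finset.range (n + 1), c * (n.choose j : ℝ) :=
        Finset.sum_le_sum_of_subset_of_nonneg hT fun _ _ _ => by positivity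
    _ = 2 ^ n * c := by
        rw [← Finset.mul_sum, mul_comm]
        congr 1
        exact_mod_cast Nat.sum_range_choose n

/-- Polynomials of degree at most `2 N + 1` close to `0` near `0` and close to `1` near `1`, at a
geometric rate in `N`. -/
lemma exists_smoothstep (N : ℕ) : ∃ S : Polynomial ℂ, S.natDegree ≤ 2 * N + 1 ∧
    ∀ (x : ℂ) (δ : ℝ), δ ≤ 1 / 2 →
      (‖x‖ ≤ δ → ‖S.eval x‖ ≤ (8 * δ) ^ N) ∧ (‖1 - x‖ ≤ δ → ‖1 - S.eval x‖ ≤ (8 * δ) ^ N) := by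
  set T := Finset.range (2 * N + 1 + 1) with hTdef
  -- The upper half of the binomial expansion of `(X + (1 - X)) ^ (2N + 1)`. The exponent is odd, so
  -- every term of `S` contains `X ^ (N + 1)` and every term of `1 - S` contains `(1 - X) ^ (N +
  -- 1)`.
  set S : Polynomial ℂ := ∑ j ∈ T with N < j,
    Polynomial.X ^ j * (1 - Polynomial.X) ^ (2 * N + 1 - j) *
      (((2 * N + 1).choose j : ℕ) : Polynomial ℂ) with hS
  have hbound : ∀ δ : ℝ, 0 ≤ δ → δ ≤ 1 / 2 →
      (2 : ℝ) ^ (2 * N + 1) * (δ ^ (N + 1) * 2 ^ N) ≤ (8 * δ) ^ N := by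
    intro δ hδ0 hδ
    have h8 : (2 : ℝ) ^ (2 * N + 1) * (δ ^ (N + 1) * 2 ^ N) = (8 * δ) ^ N * (2 * δ) := by
      rw [pow_succ, pow_mul, pow_succ δ, mul_pow, show (8 : ℝ) = 2 ^ 2 * 2 by norm_num, mul_pow]
      ring
    rw [h8]
    exact mul_le_of_le_one_right (by positivity) (by linarith)
  have heval : ∀ x, S.eval x = ∑ j ∈ T with N < j,
      x ^ j * (1 - x) ^ (2 * N + 1 - j) * ((2 * N + 1).choose j : ℂ) := by
    intro x
    simp [hS, Polynomial.eval_finsetSum]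
  have heval' : ∀ x, 1 - S.eval x = ∑ j ∈ T with ¬ N < j,
      x ^ j * (1 - x) ^ (2 * N + 1 - j) * ((2 * N + 1).choose j : ℂ) := by
    intro x
    rw [heval, sub_eq_iff_eq_add', Finset.sum_filter_add_sum_filter_not, ← add_pow]
    simp
  refine ⟨S, ?_, fun x δ hδ => ⟨fun hx => ?_, fun hx => ?_⟩⟩
  · refine Polynomial.natDegree_sum_le_of_forall_le _ _ fun j hj => ?_
    have hj2 : j ≤ 2 * N + 1 := by
      have := (Finset.mem_filter.1 hj).1
      rw [hTdef, Finset.mem_range] at this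
      omega
    have h1 : (1 - Polynomial.X : Polynomial ℂ).natDegree ≤ 1 := by
      refine (Polynomial.natDegree_sub_le _ _).trans ?_
      simp
    have h2 : ((1 - Polynomial.X : Polynomial ℂ) ^ (2 * N + 1 - j)).natDegree ≤
        (2 * N + 1 - j) * 1 := Polynomial.natDegree_pow_le_of_le _ h1
    have h3 : ((Polynomial.X : Polynomial ℂ) ^ j).natDegree ≤ j :=
      Polynomial.natDegree_X_pow_le j
    have h4 := Polynomial.natDegree_mul_le_of_le (Polynomial.natDegree_mul_le_of_le h3 h2)
      (Polynomial.natDegree_natCast ((2 * N + 1).choose j) (R := ℂ)).le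
    omega
  · have hδ0 : 0 ≤ δ := (norm_nonneg x).trans hx
    have h2 : ‖1 - x‖ ≤ 2 := (norm_sub_le _ _).trans (by rw [norm_one]; linarith)
    rw [heval]
    refine (norm_sum_choose_le (Finset.filter_subset _ _) (by positivity) fun j hj => ?_).trans
      (hbound δ hδ0 hδ)
    obtain ⟨-, hj⟩ := Finset.mem_filter.1 hj
    exact norm_pow_mul_pow_le (by linarith) hx h2 hj (by omega)
  · have hδ0 : 0 ≤ δ := (norm_nonneg _).trans hx
    have h2 : ‖x‖ ≤ 2 := by
      calc ‖x‖ = ‖1 - (1 - x)‖ := by ring_nf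
        _ ≤ 2 := (norm_sub_le _ _).trans (by rw [norm_one]; linarith)
    rw [heval']
    refine (norm_sum_choose_le (Finset.filter_subset _ _) (by positivity) fun j hj => ?_).trans
      (hbound δ hδ0 hδ)
    obtain ⟨-, hj⟩ := Finset.mem_filter.1 hj
    rw [mul_comm]
    exact norm_pow_mul_pow_le (by linarith) hx h2 (by omega) (by omega)

/-! ### Best approximation and extension by zero -/

section PolyDist

variable {E : Set ℂ} {f : ℂ → ℂ} {n : ℕ}

lemma polyDist_nonneg (E : Set ℂ) (f : ℂ → ℂ) (n : ℕ) : 0 ≤ polyDist E f n :=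
  Real.iInf_nonneg fun _ => supNorm_nonneg _ _

lemma polyDist_le_supNorm_sub {p : Polynomial ℂ} (hp : p.natDegree ≤ n) :
    polyDist E f n ≤ supNorm E fun z => f z - p.eval z :=
  ciInf_le (f := fun p : {p : Polynomial ℂ // p.natDegree ≤ n} =>
    supNorm E fun z => f z - p.1.eval z)
    ⟨0, by rintro _ ⟨q, rfl⟩; exact supNorm_nonneg _ _⟩ ⟨p, hp⟩

lemma exists_supNorm_sub_lt {c : ℝ} (h : polyDist E f n < c) :
    ∃ p : Polynomial ℂ, p.natDegree ≤ n ∧ supNorm E (fun z => f z - p.eval z) < c := by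
  have : Nonempty {p : Polynomial ℂ // p.natDegree ≤ n} := ⟨⟨0, by simp⟩⟩
  obtain ⟨p, hp⟩ := exists_lt_of_ciInf_lt h
  exact ⟨p.1, p.2, hp⟩

lemma polyDist_le_supNorm (E : Set ℂ) (f : ℂ → ℂ) (n : ℕ) : polyDist E f n ≤ supNorm E f := by
  simpa using polyDist_le_supNorm_sub (E := E) (f := f) (p := 0) (n := n) (by simp)

lemma polyDist_anti (E : Set ℂ) (f : ℂ → ℂ) : Antitone (polyDist E f) := by
  intro m n hmn
  refine le_of_forall_gt fun c hc => ?_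
  obtain ⟨p, hp, hlt⟩ := exists_supNorm_sub_lt hc
  exact (polyDist_le_supNorm_sub (hp.trans hmn)).trans_lt hlt

end PolyDist

/-- Extension by zero to a disjoint component changes the approximation numbers only by a linear
change of the degree and a geometrically small error. -/
theorem exists_polyDist_union_le {A B : Set ℂ} (hA : IsCompact A) (hB : IsCompact B)
    (hAB : Disjoint A B) (hAconv : PolyConvex A) (hBconv : PolyConvex B) (hcap : 0 < logCap A) :
    ∃ m : ℕ, 1 ≤ m ∧ ∀ f : ℂ → ℂ, ContinuousOn f A → (∀ z ∈ B, f z = 0) → ∀ n : ℕ, 1 ≤ n →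
      polyDist (A ∪ B) f (m * n) ≤ polyDist A f n + 2 * supNorm A f * (1 / 2) ^ n := by
  obtain ⟨M, hM, hBW⟩ := exists_norm_eval_le_pow_mul hA hB hcap
  have hM0 : 0 < M := one_pos.trans_le hM
  obtain ⟨q, hqA, hqB⟩ := exists_polynomial_separating hA hB hAB hAconv hBconv
    -- Chosen so that the smoothstep error `(8 ε) ^ n` is `(2M)⁻ⁿ`: it absorbs the growth `M ^ n` on
    -- `B` and leaves `2⁻ⁿ`.
    (ε := 1 / (16 * M)) (by positivity)
  have hδ : 1 / (16 * M) ≤ 1 / 2 := by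
    rw [div_le_div_iff₀ (by positivity) two_pos]
    linarith
  have h8 : 8 * (1 / (16 * M)) = 1 / 2 * M⁻¹ := by
    field_simp
    norm_num
  -- The degree of `p * S.comp q` is at most `n + (2n + 1) deg q`, and `2n + 1 ≤ 3n` for `n ≥ 1`.
  refine ⟨1 + 3 * q.natDegree, by omega, fun f hf hfB n hn => ?_⟩
  refine le_of_forall_pos_le_add fun ε hε => ?_
  obtain ⟨p, hp, hlt⟩ := exists_supNorm_sub_lt
    (lt_add_of_pos_right (polyDist A f n) (half_pos hε))
  obtain ⟨S, hSdeg, hS⟩ := exists_smoothstep n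
  set e := supNorm A fun z => f z - p.eval z
  -- Bounds `p` on `A`: its error there is below `polyDist A f n + ε / 2`, hence below `supNorm A f
  -- + ε / 2`.
  set P := 2 * supNorm A f + ε / 2
  have hP0 : 0 ≤ P := by
    have := supNorm_nonneg A f
    positivity
  have he0 : 0 ≤ e := supNorm_nonneg _ _
  have he : ∀ z ∈ A, ‖f z - p.eval z‖ ≤ e := fun z hz =>
    norm_le_supNorm (f := fun z => f z - p.eval z) hA (hf.sub p.continuous.continuousOn) hz
  have hpA : ∀ z ∈ A, ‖p.eval z‖ ≤ P := by
    intro z hz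
    have h1 := norm_le_supNorm hA hf hz
    have h2 := polyDist_le_supNorm A f n
    calc ‖p.eval z‖ = ‖f z - (f z - p.eval z)‖ := by ring_nf
      _ ≤ ‖f z‖ + ‖f z - p.eval z‖ := norm_sub_le _ _
      _ ≤ P := by
        have := he z hz
        simp only [P]
        linarith
  have hpB : ∀ z ∈ B, ‖p.eval z‖ ≤ M ^ n * P := fun z hz =>
    (hBW p P hpA z hz).trans (by gcongr)
  have hdeg : (p * S.comp q).natDegree ≤ (1 + 3 * q.natDegree) * n := by
    have h1 : (S.comp q).natDegree ≤ (2 * n + 1) * q.natDegree :=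
      Polynomial.natDegree_comp_le.trans (Nat.mul_le_mul_right _ hSdeg)
    have h2 := Polynomial.natDegree_mul_le_of_le hp h1
    nlinarith [Nat.zero_le q.natDegree]
  have hη : ((1 : ℝ) / 2 * M⁻¹) ^ n ≤ (1 / 2) ^ n := by
    have : M⁻¹ ≤ 1 := inv_le_one_of_one_le₀ hM
    gcongr
    linarith
  refine (polyDist_le_supNorm_sub hdeg).trans ((supNorm_le (C := e + P * (1 / 2) ^ n)
    (by positivity) ?_).trans ?_)
  · rintro z (hz | hz)
    · have h1 := (hS _ _ hδ).2 (hqA z hz)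
      rw [h8] at h1
      have h2 : f z - (p * S.comp q).eval z =
          (f z - p.eval z) + p.eval z * (1 - S.eval (q.eval z)) := by
        rw [Polynomial.eval_mul, Polynomial.eval_comp]
        ring
      rw [h2]
      refine (norm_add_le _ _).trans (add_le_add (he z hz) ?_)
      rw [norm_mul]
      exact mul_le_mul (hpA z hz) (h1.trans hη) (norm_nonneg _) hP0
    · have h1 := (hS _ _ hδ).1 (hqB z hz)
      rw [h8] at h1
      rw [hfB z hz, zero_sub, norm_neg, Polynomial.eval_mul, Polynomial.eval_comp, norm_mul]
      calc ‖p.eval z‖ * ‖S.eval (q.eval z)‖ ≤ (M ^ n * P) * (1 / 2 * M⁻¹) ^ n :=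
            mul_le_mul (hpB z hz) h1 (norm_nonneg _) (by positivity)
        _ = P * (1 / 2) ^ n := by
            rw [mul_pow, inv_pow]
            field_simp
        _ ≤ e + P * (1 / 2) ^ n := le_add_of_nonneg_left he0
  · have h1 : ((1 : ℝ) / 2) ^ n ≤ 1 := pow_le_one₀ (by norm_num) (by norm_num)
    have h2 : ε / 2 * (1 / 2) ^ n ≤ ε / 2 := mul_le_of_le_one_right (by positivity) h1
    simp only [P]
    linarith

/-! ### From approximation errors to Jackson norms -/

lemma le_two_rpow {y : ℝ} : y ≤ (2 : ℝ) ^ y := by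
  rcases le_total y 0 with hy | hy
  · exact hy.trans (by positivity)
  rcases le_total y 1 with h1 | h1
  · exact h1.trans (Real.one_le_rpow one_le_two hy)
  · have := one_add_mul_self_le_rpow_one_add (s := 1) (by norm_num) h1
    norm_num at this
    linarith

/-- Raise `y ≤ 2 ^ y`, taken at `y = n / l`, to the power `l`. This is the source of the factor `l ^
l` in the final constant. -/
lemma rpow_mul_half_pow_le {l : ℝ} (hl : 0 < l) (n : ℕ) :
    (n : ℝ) ^ l * (1 / 2) ^ n ≤ l ^ l := by
  have h1 : (n : ℝ) / l ≤ (2 : ℝ) ^ ((n : ℝ) / l) := le_two_rpow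
  have h2 : (n : ℝ) ≤ l * (2 : ℝ) ^ ((n : ℝ) / l) := by
    rwa [div_le_iff₀' hl] at h1
  have h3 : (n : ℝ) ^ l ≤ l ^ l * 2 ^ n := by
    calc (n : ℝ) ^ l ≤ (l * (2 : ℝ) ^ ((n : ℝ) / l)) ^ l :=
          Real.rpow_le_rpow (by positivity) h2 hl.le
      _ = l ^ l * 2 ^ n := by
          rw [Real.mul_rpow hl.le (by positivity), ← Real.rpow_mul (by norm_num),
            div_mul_cancel₀ _ hl.ne', Real.rpow_natCast]
  rw [one_div, inv_pow]
  exact mul_inv_le_of_le_mul₀ (by positivity) (by positivity) h3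

lemma supNorm_union_le {A B : Set ℂ} {f : ℂ → ℂ} (hA : IsCompact A) (hf : ContinuousOn f A)
    (hfB : ∀ z ∈ B, f z = 0) : supNorm (A ∪ B) f ≤ supNorm A f := by
  refine supNorm_le (supNorm_nonneg _ _) ?_
  rintro z (hz | hz)
  · exact norm_le_supNorm hA hf hz
  · rw [hfB z hz, norm_zero]
    exact supNorm_nonneg _ _

/-- The factor `2` pays for rounding `N` down to a multiple of `m`. -/
lemma le_two_mul_mul_div {m N : ℕ} (hm : 1 ≤ m) (hN : 1 ≤ N / m) : N ≤ 2 * m * (N / m) := by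
  have h1 := Nat.div_add_mod N m
  have h2 := Nat.mod_lt N hm
  nlinarith

/-- The degree `N` estimate behind all bounds, in terms of `n = N / m`. -/
lemma rpow_mul_polyDist_union_le {A B : Set ℂ} {f : ℂ → ℂ} {m : ℕ} (hm : 1 ≤ m)
    (h : ∀ n : ℕ, 1 ≤ n →
      polyDist (A ∪ B) f (m * n) ≤ polyDist A f n + 2 * supNorm A f * (1 / 2) ^ n)
    {l : ℝ} (hl : 0 ≤ l) {N : ℕ} (hN : 1 ≤ N / m) :
    (N : ℝ) ^ l * polyDist (A ∪ B) f N ≤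
      (2 * m : ℝ) ^ l * (((N / m : ℕ) : ℝ) ^ l * polyDist A f (N / m) +
        2 * supNorm A f * (((N / m : ℕ) : ℝ) ^ l * (1 / 2) ^ (N / m))) := by
  have h1 : (N : ℝ) ≤ 2 * m * ((N / m : ℕ) : ℝ) := by exact_mod_cast le_two_mul_mul_div hm hN
  have h2 := (polyDist_anti (A ∪ B) f (Nat.mul_div_le N m)).trans (h _ hN)
  calc (N : ℝ) ^ l * polyDist (A ∪ B) f N
      ≤ (2 * m * ((N / m : ℕ) : ℝ)) ^ l *
          (polyDist A f (N / m) + 2 * supNorm A f * (1 / 2) ^ (N / m)) :=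
        mul_le_mul (Real.rpow_le_rpow (by positivity) h1 hl) h2 (polyDist_nonneg _ _ _)
          (by positivity)
    _ = _ := by
        rw [Real.mul_rpow (by positivity) (by positivity)]
        ring

lemma mem_sClass_union {A B : Set ℂ} {f : ℂ → ℂ} {m : ℕ} (hm : 1 ≤ m)
    (h : ∀ n : ℕ, 1 ≤ n →
      polyDist (A ∪ B) f (m * n) ≤ polyDist A f n + 2 * supNorm A f * (1 / 2) ^ n)
    (hf : ContinuousOn f (A ∪ B)) (hfA : f ∈ sClass A) : f ∈ sClass (A ∪ B) := by
  refine ⟨hf, fun l hl => ?_⟩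
  have hdiv : Tendsto (fun N : ℕ => N / m) atTop atTop := Nat.tendsto_div_const_atTop (by omega)
  have h1 := hfA.2 l hl
  have h2 := tendsto_pow_const_mul_const_pow_of_abs_lt_one l
    (show |(1 / 2 : ℝ)| < 1 by rw [abs_of_pos] <;> norm_num)
  have h3 := ((h1.add (h2.const_mul (2 * supNorm A f))).const_mul ((2 * m : ℝ) ^ l)).comp hdiv
  simp only [mul_zero, add_zero] at h3
  refine squeeze_zero' (Eventually.of_forall fun N =>
    mul_nonneg (by positivity) (polyDist_nonneg _ _ _)) ?_ h3
  filter_upwards [hdiv.eventually_ge_atTop 1] with N hN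
  simpa only [Real.rpow_natCast, Function.comp_apply] using rpow_mul_polyDist_union_le hm h (Nat.cast_nonneg l) hN

lemma jacksonNorm_union_le {A B : Set ℂ} {f : ℂ → ℂ} {m : ℕ} (hm : 1 ≤ m)
    (h : ∀ n : ℕ, 1 ≤ n →
      polyDist (A ∪ B) f (m * n) ≤ polyDist A f n + 2 * supNorm A f * (1 / 2) ^ n)
    (hsup : supNorm (A ∪ B) f ≤ supNorm A f) {l : ℝ} (hl : 1 ≤ l) :
    jacksonNorm (A ∪ B) f l ≤ ENNReal.ofReal ((8 * m * l) ^ l) * jacksonNorm A f l := by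
  have hl0 : 0 < l := one_pos.trans_le hl
  have hm' : (1 : ℝ) ≤ m := by exact_mod_cast hm
  set F := supNorm A f with hF
  have hF0 : 0 ≤ F := supNorm_nonneg _ _
  set K : ℝ := (2 * m : ℝ) ^ l * l ^ l with hK
  have hll : 1 ≤ l ^ l := Real.one_le_rpow hl hl0.le
  have h2m : 1 ≤ (2 * m : ℝ) ^ l := Real.one_le_rpow (by linarith) hl0.le
  have hK1 : 1 ≤ K := one_le_mul_of_one_le_of_one_le h2m hll
  have hFJ : ENNReal.ofReal F ≤ jacksonNorm A f l := le_self_add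
  have hterm : ∀ N : ℕ, 1 ≤ N → ENNReal.ofReal ((N : ℝ) ^ l * polyDist (A ∪ B) f N) ≤
      ENNReal.ofReal (3 * K) * jacksonNorm A f l := by
    intro N _
    -- For `N < m` no degree `m * n` with `n ≥ 1` is available; there the zero polynomial and `N ≤
    -- 2m` suffice.
    rcases Nat.eq_zero_or_pos (N / m) with h0 | hpos
    · have hNm : (N : ℝ) ≤ 2 * m := by
        have h1 : N < m := (Nat.div_eq_zero_iff_lt hm).1 h0
        have h2 : (N : ℝ) ≤ m := by exact_mod_cast h1.le
        linarith
      have h1 : (N : ℝ) ^ l * polyDist (A ∪ B) f N ≤ 3 * K * F := by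
        refine mul_le_mul ?_ ((polyDist_le_supNorm _ _ _).trans hsup) (polyDist_nonneg _ _ _)
          (by positivity)
        have h2 : (N : ℝ) ^ l ≤ (2 * m : ℝ) ^ l := Real.rpow_le_rpow (by positivity) hNm hl0.le
        have h3 : (2 * m : ℝ) ^ l ≤ K := le_mul_of_one_le_right (by positivity) hll
        linarith
      refine (ENNReal.ofReal_le_ofReal h1).trans ?_
      rw [ENNReal.ofReal_mul (by positivity)]
      gcongr
    · set n := N / m
      have h1 := rpow_mul_polyDist_union_le hm h hl0.le hpos
      have hd0 : 0 ≤ (n : ℝ) ^ l * polyDist A f n :=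
        mul_nonneg (by positivity) (polyDist_nonneg _ _ _)
      have h2 : (N : ℝ) ^ l * polyDist (A ∪ B) f N ≤
          3 * K * (F + (n : ℝ) ^ l * polyDist A f n) := by
        refine h1.trans ?_
        have h6 : 3 * K * (F + (n : ℝ) ^ l * polyDist A f n) =
            (2 * m : ℝ) ^ l * (3 * l ^ l * (F + (n : ℝ) ^ l * polyDist A f n)) := by
          rw [hK]
          ring
        rw [h6]
        refine mul_le_mul_of_nonneg_left ?_ (by positivity)
        have h3 := mul_le_mul_of_nonneg_left (rpow_mul_half_pow_le hl0 n)
          (mul_nonneg zero_le_two hF0)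
        have h4 := mul_le_mul_of_nonneg_right hll hd0
        have h5 : 0 ≤ l ^ l * F := by positivity
        linarith
      refine (ENNReal.ofReal_le_ofReal h2).trans ?_
      rw [ENNReal.ofReal_mul (by positivity), ENNReal.ofReal_add hF0 hd0]
      gcongr
      exact add_le_add le_rfl (le_iSup₂_of_le n hpos le_rfl)
  calc jacksonNorm (A ∪ B) f l
      ≤ jacksonNorm A f l + ENNReal.ofReal (3 * K) * jacksonNorm A f l :=
        add_le_add ((ENNReal.ofReal_le_ofReal hsup).trans hFJ) (iSup₂_le hterm)
    _ = ENNReal.ofReal (1 + 3 * K) * jacksonNorm A f l := by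
        rw [ENNReal.ofReal_add zero_le_one (by positivity), ENNReal.ofReal_one, add_mul, one_mul]
    _ ≤ _ := by
        gcongr
        -- Since `K ≥ 1` and `l ≥ 1`, `1 + 3K ≤ 4K ≤ 4 ^ l * K = (8 m l) ^ l`.
        have h4 : (4 : ℝ) ≤ 4 ^ l := Real.self_le_rpow_of_one_le (by norm_num) hl
        have h5 : (8 * m * l : ℝ) ^ l = 4 ^ l * K := by
          rw [hK, ← Real.mul_rpow (by positivity) hl0.le, ← Real.mul_rpow (by norm_num)
            (by positivity)]
          ring_nf
        rw [h5]
        nlinarith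

end PolyApprox

theorem lemma4p2 (E A B : Set ℂ) (hE : E = A ∪ B)
    (hA : IsCompact A) (hB : IsCompact B) (hAB : Disjoint A B)
    (hAconv : PolyApprox.PolyConvex A) (hBconv : PolyApprox.PolyConvex B)
    (hAcap : 0 < PolyApprox.logCap A) :
    ∃ c : ℝ, 1 ≤ c ∧
      ∀ f : ℂ → ℂ, ContinuousOn f E → f ∈ PolyApprox.sClass A → (∀ z ∈ B, f z = 0) →
        f ∈ PolyApprox.sClass E ∧
          ∀ l : ℝ, 1 ≤ l →
            PolyApprox.jacksonNorm E f l ≤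
              ENNReal.ofReal ((c * l) ^ l) * PolyApprox.jacksonNorm A f l := by
  subst hE
  obtain ⟨m, hm, h⟩ := PolyApprox.exists_polyDist_union_le hA hB hAB hAconv hBconv hAcap
  have hm' : (1 : ℝ) ≤ m := by exact_mod_cast hm
  refine ⟨8 * m, by linarith, fun f hf hfA hfB => ?_⟩
  have hfm := h f hfA.1 hfB
  exact ⟨PolyApprox.mem_sClass_union hm hfm hf hfA, fun l hl =>
    PolyApprox.jacksonNorm_union_le hm hfm (PolyApprox.supNorm_union_le hA hfA.1 hfB) hl⟩
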